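/- **Theorem.** Let $\psi=\Gamma'/\Gamma$ be the digamma function, $\psi'$ its derivative, $\gamma$ the Euler–Mascheroni constant, and $${}_4F_3\!\left(\begin{matrix}1,1,1,m-c\\2,2,m\end{matrix}\,\middle|\,1\right)=\sum_{k\ge 0}\frac{(1)_k^3\,(m-c)_k}{(2)_k^2\,(m)_k\,k!},\qquad (x)_k=x(x+1)\cdots(x+k-1).$$ Let $c,m\in\mathbb C$ with $\Re(c)>-1$, $c\neq 0$, $\Re(m-c)>0$ and $m\notin\{0,1\}$. Then the series defining this ${}_4F_3$ converges absolutely, and the following hold. (a) If $\Re(m-c)>1$, then, with absolute convergence of the left-hand side, $$\sum_{l=0}^{\infty}\frac{\Gamma(c+l)\,\psi(1+l)^2}{\Gamma(m+l)}=-\frac{\Gamma(c)}{\Gamma(m)}\,{}_4F_3\!\left(\begin{matrix}1,1,1,m-c\\2,2,m\end{matrix}\,\middle|\,1\right)+\frac{\Gamma(c)}{\Gamma(m-1)(m-1-c)}\Big[\frac{\pi^2}{6}+\gamma^2+\psi(m-1-c)\big(2\gamma-\psi(m-1)-\psi(c)\big)+\psi'(m-1-c)+\psi(m-1-c)^2-\psi(m-1)\big(2\gamma-\psi(c)\big)\Big].$$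 (b) If $m\neq c+1$, then, with absolute convergence of the left-hand side, $$\sum_{l=0}^{\infty}\frac{\Gamma(c+l)\,\psi'(1+l)}{\Gamma(m+l)}=\frac{\Gamma(c)}{\Gamma(m)}\,{}_4F_3\!\left(\begin{matrix}1,1,1,m-c\\2,2,m\end{matrix}\,\middle|\,1\right)-\frac{\Gamma(c)}{\Gamma(m-1)(m-1-c)}\Big(\psi'(m-1)-\big[\psi(m-1)-\psi(m-1-c)\big]\big[\psi(m-1)-\psi(c)\big]\Big).$$ -/

import Mathlib

/-- The `k`-th term
`(a₁)ₖ ⋯ (a_p)ₖ / ((b₁)ₖ ⋯ (b_q)ₖ) * z ^ k / k!`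
of the generalized hypergeometric series `pFq(a₁, …, a_p; b₁, …, b_q; z)`, where `(x)ₖ` is the
rising factorial `x (x + 1) ⋯ (x + k - 1)`. -/
noncomputable def genHypTerm (as bs : List ℂ) (z : ℂ) (k : ℕ) : ℂ :=
  (as.map fun a => (ascPochhammer ℂ k).eval a).prod /
    (bs.map fun b => (ascPochhammer ℂ k).eval b).prod * (z ^ k / (k.factorial : ℂ))

/-- The generalized hypergeometric function `pFq(as; bs; z)`, as the sum of its defining series. -/
noncomputable def genHyp (as bs : List ℂ) (z : ℂ) : ℂ :=
  ∑' k : ℕ, genHypTerm as bs z k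

/-- The trigamma function: the derivative of the digamma function. -/
noncomputable def trigamma : ℂ → ℂ := deriv Complex.digamma

/-! Write `b = m - 1` and `a = c`. Up to the factor Γ(c)/Γ(m), the weight Γ(c+l)/Γ(m+l) is
(a)ₗ/(b+1)ₗ, which is b/(b-a) times the difference of consecutive ratios (a)ₗ/(b)ₗ. Summation by
parts (`hasSum_pochRatio_mul_of_hasSum_sub`) thus replaces ψ² or ψ' by its increments, which are
rational in l and the harmonic numbers. What remains is Σ (a)ₖ/(b)ₖ weighted by 1/k, Hₖ₋₁/k and
1/k².

The first two sums have closed forms. Each is proved by checking that sum and claimed value change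
equally under b → b+1 and that their difference tends to 0 as b moves right. The 1/k² sum,
`pochSumSq a b`, has a reflection formula pairing `pochSumSq u (u + v)` with `pochSumSq v (u + v)`,
proved by the same shift-and-limit method. With u = m-1-c and v = c, the partner sum is a multiple
of the ₄F₃, hence its appearance in both parts.

The analytic input is the series for ψ and ψ' in the right half plane, their recurrences off the
poles, and the growth (a)ₙ/(b)ₙ = O(n^Re(a-b)). -/

open Filter Topology Asymptotics

/-! ### Series for log Γ, ψ and ψ' in the right half plane. -/

/-- The `k`-th summand of `-log Γ(z) - log z` in the Weierstrass-type expansion. -/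
noncomputable def logGammaTerm (k : ℕ) (z : ℂ) : ℂ :=
  Complex.log (z + (k + 1 : ℕ)) - Complex.log ((k + 1 : ℕ) : ℂ)
    - z * ((Real.log (k + 2) - Real.log (k + 1) : ℝ) : ℂ)

noncomputable def logGammaTermDeriv (k : ℕ) (z : ℂ) : ℂ :=
  (z + (k + 1 : ℕ))⁻¹ - ((Real.log (k + 2) - Real.log (k + 1) : ℝ) : ℂ)

lemma add_natCast_ne_zero_of_re_pos {z : ℂ} (hz : 0 < z.re) (k : ℕ) : z + k ≠ 0 := by
  intro h
  have := congrArg Complex.re h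
  simp at this
  have : (0 : ℝ) ≤ k := k.cast_nonneg
  linarith

lemma ne_neg_natCast_of_re_pos {z : ℂ} (hz : 0 < z.re) (k : ℕ) : z ≠ -k := fun h =>
  add_natCast_ne_zero_of_re_pos hz k (by rw [h]; ring)

lemma le_norm_add_natCast {z : ℂ} (hz : 0 < z.re) (k : ℕ) : (k : ℝ) ≤ ‖z + k‖ := by
  refine le_trans ?_ (Complex.re_le_norm _)
  simp [hz.le]

lemma tendsto_inv_add_natCast (z : ℂ) : Tendsto (fun n : ℕ => (z + n)⁻¹) atTop (𝓝 0) := by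
  refine tendsto_inv₀_cobounded.comp (tendsto_norm_atTop_iff_cobounded.1 ?_)
  refine tendsto_atTop_mono (f := fun n : ℕ => (n : ℝ) - ‖z‖) (fun n => ?_)
    (tendsto_atTop_add_const_right _ _ tendsto_natCast_atTop_atTop)
  have := norm_sub_le (z + n) z
  simp at this
  linarith

lemma summable_one_div_succ_sq : Summable fun k : ℕ => 1 / ((k : ℝ) + 1) ^ 2 := by
  have := (summable_nat_add_iff (f := fun k : ℕ => 1 / (k : ℝ) ^ 2) 1).2
    (Real.summable_one_div_nat_pow.2 one_lt_two)
  simpa using this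

lemma hasDerivAt_logGammaTerm (k : ℕ) {z : ℂ} (hz : 0 < z.re) :
    HasDerivAt (logGammaTerm k) (logGammaTermDeriv k z) z := by
  have h1 : HasDerivAt (fun z : ℂ => z + (k + 1 : ℕ)) 1 z := (hasDerivAt_id z).add_const _
  have hs : z + (k + 1 : ℕ) ∈ Complex.slitPlane := by
    left
    have : (0 : ℝ) ≤ k := k.cast_nonneg
    simp; linarith
  have h2 := ((h1.clog hs).sub_const (Complex.log ((k + 1 : ℕ) : ℂ))).sub
    ((hasDerivAt_id z).mul_const ((Real.log (k + 2) - Real.log (k + 1) : ℝ) : ℂ))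
  refine h2.congr_deriv ?_
  simp [logGammaTermDeriv]

/-- Both 1/(z+k+1) and log((k+2)/(k+1)) are 1/(k+1) up to O(1/k²). The bound is uniform for ‖z‖ < R,
as termwise differentiation requires. -/
lemma norm_logGammaTermDeriv_le (k : ℕ) {z : ℂ} (hz : 0 < z.re) {R : ℝ} (hR : ‖z‖ < R) :
    ‖logGammaTermDeriv k z‖ ≤ (R + 1) * (1 / ((k : ℝ) + 1) ^ 2) := by
  have hk : (0 : ℝ) < (k : ℝ) + 1 := by positivity
  have hlog : Real.log (k + 2) - Real.log (k + 1) = Real.log ((k + 2) / (k + 1)) :=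
    (Real.log_div (by positivity) (by positivity)).symm
  have hu : Real.log ((k + 2) / (k + 1) : ℝ) ≤ 1 / ((k : ℝ) + 1) := by
    have := Real.log_le_sub_one_of_pos (x := ((k : ℝ) + 2) / (k + 1)) (by positivity)
    have e : ((k : ℝ) + 2) / (k + 1) - 1 = 1 / (k + 1) := by field_simp; ring
    linarith
  have hl : 1 / ((k : ℝ) + 1) - 1 / (k + 1) ^ 2 ≤ Real.log ((k + 2) / (k + 1) : ℝ) := by
    have := Real.one_sub_inv_le_log_of_pos (x := ((k : ℝ) + 2) / (k + 1)) (by positivity)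
    have e : 1 - (((k : ℝ) + 2) / (k + 1))⁻¹ = 1 / (k + 2) := by field_simp; ring
    have e2 : 1 / ((k : ℝ) + 1) - 1 / (k + 1) ^ 2 ≤ 1 / (k + 2) := by
      rw [div_sub_div _ _ hk.ne' (by positivity), div_le_div_iff₀ (by positivity) (by positivity)]
      nlinarith [hk]
    linarith
  have h1 : ‖(z + (k + 1 : ℕ))⁻¹ - ((1 / ((k : ℝ) + 1) : ℝ) : ℂ)‖ ≤ R * (1 / ((k : ℝ) + 1) ^ 2) := by
    have hne := add_natCast_ne_zero_of_re_pos hz (k + 1)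
    have hk' : ((k : ℂ) + 1) ≠ 0 := by exact_mod_cast hk.ne'
    have e : (z + (k + 1 : ℕ))⁻¹ - ((1 / ((k : ℝ) + 1) : ℝ) : ℂ)
        = -z / ((z + (k + 1 : ℕ)) * ((k : ℂ) + 1)) := by
      push_cast at hne ⊢
      field_simp
      ring
    have hn : ‖(k : ℂ) + 1‖ = (k : ℝ) + 1 := by
      have := Complex.norm_natCast (k + 1)
      push_cast at this
      exact this
    rw [e, norm_div, norm_neg, norm_mul, hn, mul_one_div]
    have h3 := le_norm_add_natCast hz (k + 1)
    have h4 : ((k : ℝ) + 1) ^ 2 ≤ ‖z + (k + 1 : ℕ)‖ * (k + 1) := by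
      rw [sq]
      push_cast at h3 ⊢
      gcongr
    exact div_le_div₀ ((norm_nonneg z).trans hR.le) hR.le (by positivity) h4
  have h2 : ‖((1 / ((k : ℝ) + 1) : ℝ) : ℂ) - ((Real.log (k + 2) - Real.log (k + 1) : ℝ) : ℂ)‖
      ≤ 1 / ((k : ℝ) + 1) ^ 2 := by
    rw [← Complex.ofReal_sub, Complex.norm_real, Real.norm_eq_abs, abs_le, hlog]
    have : 0 ≤ 1 / ((k : ℝ) + 1) ^ 2 := by positivity
    constructor <;> linarith
  calc ‖logGammaTermDeriv k z‖ = ‖((z + (k + 1 : ℕ))⁻¹ - ((1 / ((k : ℝ) + 1) : ℝ) : ℂ)) +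
        (((1 / ((k : ℝ) + 1) : ℝ) : ℂ) - ((Real.log (k + 2) - Real.log (k + 1) : ℝ) : ℂ))‖ := by
        rw [logGammaTermDeriv]; congr 1; ring
    _ ≤ _ := norm_add_le _ _
    _ ≤ R * (1 / ((k : ℝ) + 1) ^ 2) + 1 / ((k : ℝ) + 1) ^ 2 := add_le_add h1 h2
    _ = _ := by ring

/-- The linear correction is log((k+2)/(k+1)) rather than 1/(k+1) precisely for this: z = 1 becomes
a base point where convergence is trivial, and no γ enters the expansion. -/
lemma logGammaTerm_one (k : ℕ) : logGammaTerm k 1 = 0 := by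
  have h1 : (1 : ℂ) + (k + 1 : ℕ) = (((k : ℝ) + 2 : ℝ) : ℂ) := by push_cast; ring
  have h2 : ((k + 1 : ℕ) : ℂ) = (((k : ℝ) + 1 : ℝ) : ℂ) := by push_cast; ring
  rw [logGammaTerm, h1, h2, ← Complex.ofReal_log (by positivity),
    ← Complex.ofReal_log (by positivity)]
  push_cast
  ring

/-- The convex open half disc on which the expansions are differentiated termwise. -/
def rightHalfDisc (R : ℝ) : Set ℂ := {z | 0 < z.re} ∩ Metric.ball 0 R

lemma isOpen_rightHalfDisc (R : ℝ) : IsOpen (rightHalfDisc R) :=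
  (isOpen_lt continuous_const Complex.continuous_re).inter Metric.isOpen_ball

lemma isPreconnected_rightHalfDisc (R : ℝ) : IsPreconnected (rightHalfDisc R) :=
  ((convex_halfSpace_re_gt 0).inter (convex_ball _ _)).isPreconnected

lemma mem_rightHalfDisc {z : ℂ} (hz : 0 < z.re) : z ∈ rightHalfDisc (‖z‖ + 2) :=
  ⟨hz, by simp⟩

lemma one_mem_rightHalfDisc (z : ℂ) : (1 : ℂ) ∈ rightHalfDisc (‖z‖ + 2) :=
  ⟨by simp, by
    have := norm_nonneg z
    simp; linarith⟩

lemma summable_logGammaTerm {z : ℂ} (hz : 0 < z.re) : Summable fun k => logGammaTerm k z := by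
  refine summable_of_summable_hasDerivAt_of_isPreconnected
    (summable_one_div_succ_sq.mul_left (‖z‖ + 2 + 1)) (isOpen_rightHalfDisc (‖z‖ + 2))
    (isPreconnected_rightHalfDisc _) (fun k y hy => hasDerivAt_logGammaTerm k hy.1)
    (fun k y hy => norm_logGammaTermDeriv_le k hy.1 (by simpa using hy.2))
    (one_mem_rightHalfDisc z) ?_ (mem_rightHalfDisc hz)
  simp only [logGammaTerm_one]
  exact summable_zero

lemma summable_logGammaTermDeriv {z : ℂ} (hz : 0 < z.re) :
    Summable fun k => logGammaTermDeriv k z :=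
  Summable.of_norm_bounded (summable_one_div_succ_sq.mul_left (‖z‖ + 2 + 1))
    fun k => norm_logGammaTermDeriv_le k hz (by simp)

lemma hasDerivAt_tsum_logGammaTerm {z : ℂ} (hz : 0 < z.re) :
    HasDerivAt (fun z => ∑' k, logGammaTerm k z) (∑' k, logGammaTermDeriv k z) z := by
  refine hasDerivAt_tsum_of_isPreconnected
    (summable_one_div_succ_sq.mul_left (‖z‖ + 2 + 1)) (isOpen_rightHalfDisc (‖z‖ + 2))
    (isPreconnected_rightHalfDisc _) (fun k y hy => hasDerivAt_logGammaTerm k hy.1)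
    (fun k y hy => norm_logGammaTermDeriv_le k hy.1 (by simpa using hy.2))
    (one_mem_rightHalfDisc z) ?_ (mem_rightHalfDisc hz)
  simp only [logGammaTerm_one]
  exact summable_zero

/-- The logarithmic corrections telescope to (n+1)^z, the power in Euler's limit `Complex.GammaSeq`
at index n+1. -/
lemma exp_sum_logGammaTerm_mul_prod {z : ℂ} (hz : 0 < z.re) (n : ℕ) :
    Complex.exp (∑ k ∈ Finset.range n, logGammaTerm k z) * ((n + 1 : ℕ) : ℂ) ^ z * n.factorial
      = ∏ k ∈ Finset.range n, (z + (k + 1 : ℕ)) := by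
  induction n with
  | zero => simp
  | succ n ih =>
    have hn : ((n + 1 : ℕ) : ℂ) ≠ 0 := by exact_mod_cast n.succ_ne_zero
    have hn' : ((n + 1 + 1 : ℕ) : ℂ) ≠ 0 := by exact_mod_cast (n + 1).succ_ne_zero
    have h1 : ((n + 1 : ℕ) : ℂ) = (((n : ℝ) + 1 : ℝ) : ℂ) := by push_cast; ring
    have h2 : ((n + 1 + 1 : ℕ) : ℂ) = (((n : ℝ) + 2 : ℝ) : ℂ) := by push_cast; ring
    have hpow : Complex.exp (-(z * ((Real.log (n + 2) - Real.log (n + 1) : ℝ) : ℂ)))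
        * ((n + 1 + 1 : ℕ) : ℂ) ^ z = ((n + 1 : ℕ) : ℂ) ^ z := by
      rw [Complex.cpow_def_of_ne_zero hn, Complex.cpow_def_of_ne_zero hn', ← Complex.exp_add, h1, h2,
        ← Complex.ofReal_log (by positivity), ← Complex.ofReal_log (by positivity)]
      congr 1
      push_cast
      ring
    have hterm : Complex.exp (logGammaTerm n z) = (z + (n + 1 : ℕ)) / ((n + 1 : ℕ) : ℂ)
        * Complex.exp (-(z * ((Real.log (n + 2) - Real.log (n + 1) : ℝ) : ℂ))) := by
      rw [logGammaTerm, sub_eq_add_neg, Complex.exp_add, Complex.exp_sub,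
        Complex.exp_log (add_natCast_ne_zero_of_re_pos hz _), Complex.exp_log hn]
    rw [Finset.sum_range_succ, Complex.exp_add, Finset.prod_range_succ, ← ih, hterm, ← hpow,
      Nat.factorial_succ]
    push_cast at hn ⊢
    field_simp

lemma Gamma_eq_exp_tsum_logGammaTerm {z : ℂ} (hz : 0 < z.re) :
    Complex.Gamma z = z⁻¹ * Complex.exp (-∑' k, logGammaTerm k z) := by
  have hz0 : z ≠ 0 := by rintro rfl; simp at hz
  have hE := (Complex.continuous_exp.tendsto _).comp (summable_logGammaTerm hz).hasSum.tendsto_sum_nat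
  have hG := (Complex.GammaSeq_tendsto_Gamma z).comp (tendsto_add_atTop_nat 1)
  -- The last bracket is (n+1)/(z+n+1): the Euler product at n+1 has one factor more than the
  -- partial sum, besides z itself.
  have key : ∀ n : ℕ, Complex.GammaSeq z (n + 1)
      * Complex.exp (∑ k ∈ Finset.range n, logGammaTerm k z)
      = z⁻¹ * (1 - z / (z + (n + 1 : ℕ))) := by
    intro n
    have hprod : ∏ j ∈ Finset.range (n + 1 + 1), (z + (j : ℂ))
        = (∏ k ∈ Finset.range n, (z + (k + 1 : ℕ))) * (z + (n + 1 : ℕ)) * z := by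
      rw [Finset.prod_range_succ', Finset.prod_range_succ]
      simp
    have hP : ∏ k ∈ Finset.range n, (z + (k + 1 : ℕ)) ≠ 0 :=
      Finset.prod_ne_zero_iff.2 fun k _ => add_natCast_ne_zero_of_re_pos hz _
    have hne := add_natCast_ne_zero_of_re_pos hz (n + 1)
    rw [Complex.GammaSeq, hprod, Nat.factorial_succ, div_mul_eq_mul_div, div_eq_iff (by positivity)]
    have e := exp_sum_logGammaTerm_mul_prod hz n
    have : z⁻¹ * (1 - z / (z + (n + 1 : ℕ))) * ((∏ k ∈ Finset.range n, (z + (k + 1 : ℕ)))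
        * (z + (n + 1 : ℕ)) * z) = (n + 1 : ℕ) * ∏ k ∈ Finset.range n, (z + (k + 1 : ℕ)) := by
      field_simp
      ring
    rw [this, ← e]
    push_cast
    ring
  have hlim : Tendsto (fun n : ℕ => z⁻¹ * (1 - z / (z + (n + 1 : ℕ)))) atTop (𝓝 (z⁻¹ * (1 - 0))) := by
    refine (tendsto_const_nhds.sub ?_).const_mul _
    simpa [div_eq_mul_inv] using
      ((tendsto_inv_add_natCast z).comp (tendsto_add_atTop_nat 1)).const_mul z
  have := tendsto_nhds_unique ((hG.mul hE).congr key) hlim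
  rw [Complex.exp_neg, eq_mul_inv_iff_mul_eq₀ (Complex.exp_ne_zero _), this]
  simp

lemma digamma_eq_tsum {z : ℂ} (hz : 0 < z.re) :
    Complex.digamma z = -z⁻¹ - ∑' k, logGammaTermDeriv k z := by
  have hz0 : z ≠ 0 := by rintro rfl; simp at hz
  have hev : Complex.Gamma =ᶠ[𝓝 z] fun z => z⁻¹ * Complex.exp (-∑' k, logGammaTerm k z) := by
    filter_upwards [(isOpen_lt continuous_const Complex.continuous_re).mem_nhds hz] with w hw
    exact Gamma_eq_exp_tsum_logGammaTerm hw
  have hd := ((hasDerivAt_inv hz0).mul (hasDerivAt_tsum_logGammaTerm hz).neg.cexp).congr_of_eventuallyEq hev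
  rw [Complex.digamma_def, logDeriv_apply, hd.deriv, Gamma_eq_exp_tsum_logGammaTerm hz]
  have := Complex.exp_ne_zero (-∑' k, logGammaTerm k z)
  simp only [Pi.neg_apply]
  field_simp
  ring

lemma hasSum_trigamma {z : ℂ} (hz : 0 < z.re) :
    HasSum (fun k : ℕ => 1 / (z + k) ^ 2) (trigamma z) := by
  have hz0 : z ≠ 0 := by rintro rfl; simp at hz
  have hb : ∀ (k : ℕ) (y : ℂ), 0 < y.re →
      ‖-1 / (y + (k + 1 : ℕ)) ^ 2‖ ≤ 1 / ((k : ℝ) + 1) ^ 2 := by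
    intro k y hy
    have := le_norm_add_natCast hy (k + 1)
    rw [norm_div, norm_pow, norm_neg, norm_one]
    push_cast at this ⊢
    gcongr
  have hd : ∀ (k : ℕ) (y : ℂ), 0 < y.re →
      HasDerivAt (logGammaTermDeriv k) (-1 / (y + (k + 1 : ℕ)) ^ 2) y := by
    intro k y hy
    exact (((hasDerivAt_id y).add_const _).inv (add_natCast_ne_zero_of_re_pos hy _)).sub_const _
  have hD := hasDerivAt_tsum_of_isPreconnected summable_one_div_succ_sq
    (isOpen_rightHalfDisc (‖z‖ + 2)) (isPreconnected_rightHalfDisc _)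
    (fun k y hy => hd k y hy.1) (fun k y hy => hb k y hy.1) (mem_rightHalfDisc hz)
    (summable_logGammaTermDeriv hz) (mem_rightHalfDisc hz)
  have hev : Complex.digamma =ᶠ[𝓝 z] fun z => -z⁻¹ - ∑' k, logGammaTermDeriv k z := by
    filter_upwards [(isOpen_lt continuous_const Complex.continuous_re).mem_nhds hz] with w hw
    exact digamma_eq_tsum hw
  have ht := (((hasDerivAt_inv hz0).neg.sub hD).congr_of_eventuallyEq hev).deriv
  have hs : Summable fun k : ℕ => -1 / (z + (k + 1 : ℕ)) ^ 2 :=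
    Summable.of_norm_bounded summable_one_div_succ_sq fun k => hb k z hz
  rw [← hasSum_nat_add_iff' 1, trigamma, ht]
  convert hs.hasSum.neg using 1
  · funext k; rw [neg_div, neg_neg]
  · simp

lemma hasSum_digamma_sub {z w : ℂ} (hz : 0 < z.re) (hw : 0 < w.re) :
    HasSum (fun k : ℕ => (w + k)⁻¹ - (z + k)⁻¹) (Complex.digamma z - Complex.digamma w) := by
  rw [digamma_eq_tsum hz, digamma_eq_tsum hw, ← hasSum_nat_add_iff' 1]
  convert (summable_logGammaTermDeriv hw).hasSum.sub (summable_logGammaTermDeriv hz).hasSum using 1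
  · funext k; simp [logGammaTermDeriv]
  · simp; ring

/-! ### Recurrences and decay of ψ differences and of ψ' off the poles. -/

lemma ne_neg_natCast_add {z : ℂ} (hz : ∀ k : ℕ, z ≠ -k) (n k : ℕ) : z + n ≠ -k := fun h =>
  hz (n + k) (by push_cast; linear_combination h)

lemma ne_neg_natCast_add_one {z : ℂ} (hz : ∀ k : ℕ, z ≠ -k) (k : ℕ) : z + 1 ≠ -k := by
  simpa using ne_neg_natCast_add hz 1 k

lemma add_natCast_ne_zero {z : ℂ} (hz : ∀ k : ℕ, z ≠ -k) (k : ℕ) : z + k ≠ 0 := fun h =>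
  hz k (eq_neg_of_add_eq_zero_left h)

lemma ne_zero_of_ne_neg_natCast {z : ℂ} (hz : ∀ k : ℕ, z ≠ -k) : z ≠ 0 := by
  simpa using hz 0

lemma trigamma_add_one {z : ℂ} (hz : ∀ k : ℕ, z ≠ -k) :
    trigamma (z + 1) = trigamma z - 1 / z ^ 2 := by
  have hz0 := ne_zero_of_ne_neg_natCast hz
  -- Differentiating ψ(w+1) = ψ(w) + 1/w needs it on a neighbourhood. Non-poles form an open set
  -- because they are the nonzeros of the entire function 1/Γ.
  have hopen : ∀ᶠ w in 𝓝 z, ∀ k : ℕ, w ≠ -(k : ℂ) := by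
    have h1 : ∀ᶠ w in 𝓝 z, (Complex.Gamma w)⁻¹ ≠ 0 :=
      (Complex.differentiable_one_div_Gamma z).continuousAt.eventually_ne
        (inv_ne_zero (Complex.Gamma_ne_zero hz))
    filter_upwards [h1] with w hw k hk
    exact hw (by rw [(Complex.Gamma_eq_zero_iff w).2 ⟨k, hk⟩, inv_zero])
  have hdiff : ∀ w : ℂ, (∀ k : ℕ, w ≠ -k) → DifferentiableAt ℂ Complex.digamma w := by
    intro w hw
    have hopen : ∀ᶠ y in 𝓝 w, DifferentiableAt ℂ Complex.Gamma y := by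
      have h1 : ∀ᶠ y in 𝓝 w, (Complex.Gamma y)⁻¹ ≠ 0 :=
        (Complex.differentiable_one_div_Gamma w).continuousAt.eventually_ne
          (inv_ne_zero (Complex.Gamma_ne_zero hw))
      filter_upwards [h1] with y hy
      refine Complex.differentiableAt_Gamma y fun k hk => hy ?_
      rw [(Complex.Gamma_eq_zero_iff y).2 ⟨k, hk⟩, inv_zero]
    have han : AnalyticAt ℂ Complex.Gamma w := Complex.analyticAt_iff_eventually_differentiableAt.2 hopen
    exact (han.deriv.differentiableAt).div han.differentiableAt (Complex.Gamma_ne_zero hw)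
  have hev : (fun w => Complex.digamma (w + 1)) =ᶠ[𝓝 z] fun w => Complex.digamma w + w⁻¹ := by
    filter_upwards [hopen] with w hw
    exact Complex.digamma_apply_add_one w hw
  have hd := hev.deriv_eq
  rw [deriv_comp_add_const, deriv_fun_add (hdiff z hz) (differentiableAt_inv hz0)] at hd
  rw [trigamma, hd]
  simp
  ring

lemma digamma_add_natCast {z : ℂ} (hz : ∀ k : ℕ, z ≠ -k) (n : ℕ) :
    Complex.digamma (z + n) = Complex.digamma z + ∑ k ∈ Finset.range n, (z + k)⁻¹ := by
  induction n with
  | zero => simp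
  | succ n ih =>
    rw [Finset.sum_range_succ, ← add_assoc, ← ih,
      ← Complex.digamma_apply_add_one _ (ne_neg_natCast_add hz n)]
    push_cast
    rw [add_assoc]

lemma trigamma_add_natCast {z : ℂ} (hz : ∀ k : ℕ, z ≠ -k) (n : ℕ) :
    trigamma (z + n) = trigamma z - ∑ k ∈ Finset.range n, 1 / (z + k) ^ 2 := by
  induction n with
  | zero => simp
  | succ n ih =>
    rw [Finset.sum_range_succ, ← sub_sub, ← ih, ← trigamma_add_one (ne_neg_natCast_add hz n)]
    push_cast
    rw [add_assoc]

lemma exists_re_add_natCast_pos (z : ℂ) : ∃ N : ℕ, ∀ n ≥ N, 0 < (z + n).re := by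
  obtain ⟨N, hN⟩ := exists_nat_gt (-z.re)
  refine ⟨N, fun n hn => ?_⟩
  have : (N : ℝ) ≤ n := by exact_mod_cast hn
  simp
  linarith

/-- After a shift into the right half plane, the expression is a tail of the convergent series in
`hasSum_digamma_sub`. -/
lemma tendsto_digamma_sub (z w : ℂ) : Tendsto (fun n : ℕ =>
    Complex.digamma (z + n) - Complex.digamma (w + n)) atTop (𝓝 0) := by
  obtain ⟨N, hN⟩ := exists_re_add_natCast_pos z
  obtain ⟨M, hM⟩ := exists_re_add_natCast_pos w
  rw [← tendsto_add_atTop_iff_nat (N + M)]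
  have hz := hN (N + M) (by omega)
  have hw := hM (N + M) (by omega)
  have h := (hasSum_digamma_sub hz hw).tendsto_sum_nat.const_sub
    (Complex.digamma (z + (N + M : ℕ)) - Complex.digamma (w + (N + M : ℕ)))
  rw [sub_self] at h
  refine h.congr fun n => ?_
  have e : ∀ x : ℂ, x + ((n + (N + M) : ℕ) : ℂ) = x + (N + M : ℕ) + n := fun x => by
    push_cast; ring
  rw [e, e, digamma_add_natCast (ne_neg_natCast_of_re_pos hz),
    digamma_add_natCast (ne_neg_natCast_of_re_pos hw), Finset.sum_sub_distrib]
  ring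

lemma tendsto_trigamma_add_natCast (z : ℂ) :
    Tendsto (fun n : ℕ => trigamma (z + n)) atTop (𝓝 0) := by
  obtain ⟨N, hN⟩ := exists_re_add_natCast_pos z
  rw [← tendsto_add_atTop_iff_nat N]
  have hz := hN N le_rfl
  have h := (hasSum_trigamma hz).tendsto_sum_nat.const_sub (trigamma (z + N))
  rw [sub_self] at h
  refine h.congr fun n => ?_
  have e : z + ((n + N : ℕ) : ℂ) = z + N + n := by push_cast; ring
  rw [e, trigamma_add_natCast (ne_neg_natCast_of_re_pos hz)]

lemma isBigO_inv_add_natCast (z : ℂ) :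
    (fun n : ℕ => (z + n)⁻¹) =O[atTop] fun n : ℕ => ((n : ℝ))⁻¹ := by
  have h := (tendsto_natCast_div_add_atTop (𝕜 := ℂ) z).isBigO_one ℝ
  have h2 := (isBigO_refl (fun n : ℕ => ((n : ℝ))⁻¹) atTop).smul h
  refine (h2.congr' ?_ ?_)
  · filter_upwards [eventually_gt_atTop 0] with n hn
    have : (n : ℂ) ≠ 0 := by exact_mod_cast hn.ne'
    simp only [Complex.real_smul]
    push_cast
    rw [add_comm z]
    field_simp
  · exact Eventually.of_forall fun n => by simp

/-- A null sequence is the sum of its later increments, and 1/x² ≤ 2(1/x - 1/(x+1)) for x ≥ 1 makes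
the bound telescope to 2C/n. -/
lemma isBigO_inv_of_sub_succ {f : ℕ → ℂ} (hf : Tendsto f atTop (𝓝 0))
    (h : (fun n => f n - f (n + 1)) =O[atTop] fun n : ℕ => (n : ℝ)⁻¹ * (n : ℝ)⁻¹) :
    f =O[atTop] fun n : ℕ => (n : ℝ)⁻¹ := by
  obtain ⟨C, hC0, hC⟩ := h.exists_pos
  obtain ⟨N, hN⟩ := eventually_atTop.1 hC.bound
  refine IsBigO.of_bound (2 * C) ?_
  filter_upwards [eventually_ge_atTop (N + 1)] with n hn
  have hstep : ∀ M, ‖f n - f (n + M)‖ ≤ 2 * C * ((n : ℝ)⁻¹ - ((n + M : ℕ) : ℝ)⁻¹) := by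
    intro M
    induction M with
    | zero => simp
    | succ M ih =>
      have h1 := hN (n + M) (by omega)
      have hp : (1 : ℝ) ≤ ((n + M : ℕ) : ℝ) := by exact_mod_cast (by omega : 1 ≤ n + M)
      have h2 : C * ‖(((n + M : ℕ) : ℝ))⁻¹ * (((n + M : ℕ) : ℝ))⁻¹‖
          ≤ 2 * C * ((((n + M : ℕ) : ℝ))⁻¹ - ((n + (M + 1) : ℕ) : ℝ)⁻¹) := by
        have e : ((n + (M + 1) : ℕ) : ℝ) = ((n + M : ℕ) : ℝ) + 1 := by push_cast; ring
        rw [e]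
        generalize ((n + M : ℕ) : ℝ) = x at hp
        rw [Real.norm_of_nonneg (by positivity), mul_comm 2 C, mul_assoc]
        refine mul_le_mul_of_nonneg_left ?_ hC0.le
        have : 2 * (x⁻¹ - (x + 1)⁻¹) = 2 / (x * (x + 1)) := by field_simp; ring
        rw [this, ← mul_inv, ← one_div, div_le_div_iff₀ (by positivity) (by positivity)]
        nlinarith
      calc ‖f n - f (n + (M + 1))‖ = ‖(f n - f (n + M)) + (f (n + M) - f (n + M + 1))‖ := by
            rw [← add_assoc]; congr 1; ring
        _ ≤ _ := norm_add_le _ _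
        _ ≤ _ := add_le_add ih (h1.trans h2)
        _ = _ := by ring
  have hl : Tendsto (fun M => ‖f n - f (n + M)‖) atTop (𝓝 ‖f n - 0‖) := by
    refine (tendsto_const_nhds.sub ?_).norm
    exact hf.comp (tendsto_atTop_mono (fun M => Nat.le_add_left M n) tendsto_id)
  rw [sub_zero] at hl
  refine le_of_tendsto' hl fun M => (hstep M).trans ?_
  rw [Real.norm_of_nonneg (by positivity : (0 : ℝ) ≤ (n : ℝ)⁻¹)]
  refine mul_le_mul_of_nonneg_left ?_ (by positivity)
  have : (0 : ℝ) ≤ ((n + M : ℕ) : ℝ)⁻¹ := by positivity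
  linarith

lemma isBigO_digamma_sub {z w : ℂ} (hz : ∀ k : ℕ, z ≠ -k) (hw : ∀ k : ℕ, w ≠ -k) :
    (fun n : ℕ => Complex.digamma (z + n) - Complex.digamma (w + n)) =O[atTop]
      fun n : ℕ => (n : ℝ)⁻¹ := by
  refine isBigO_inv_of_sub_succ (tendsto_digamma_sub z w) ?_
  refine (((isBigO_inv_add_natCast z).mul (isBigO_inv_add_natCast w)).const_mul_left (z - w)).congr_left
    fun n => ?_
  have hz' := add_natCast_ne_zero hz n
  have hw' := add_natCast_ne_zero hw n
  push_cast
  rw [← add_assoc, ← add_assoc, Complex.digamma_apply_add_one _ (ne_neg_natCast_add hz n),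
    Complex.digamma_apply_add_one _ (ne_neg_natCast_add hw n)]
  field_simp
  ring

lemma isBigO_trigamma {z : ℂ} (hz : ∀ k : ℕ, z ≠ -k) :
    (fun n : ℕ => trigamma (z + n)) =O[atTop] fun n : ℕ => (n : ℝ)⁻¹ := by
  refine isBigO_inv_of_sub_succ (tendsto_trigamma_add_natCast z) ?_
  refine ((isBigO_inv_add_natCast z).mul (isBigO_inv_add_natCast z)).congr_left fun n => ?_
  have hz' := add_natCast_ne_zero hz n
  push_cast
  rw [← add_assoc, trigamma_add_one (ne_neg_natCast_add hz n)]
  field_simp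
  ring

/-! ### Ratios of rising factorials: contiguity and growth. -/

/-- The ratio `(a)ₖ / (b)ₖ` of rising factorials. -/
noncomputable def pochRatio (a b : ℂ) (k : ℕ) : ℂ :=
  (ascPochhammer ℂ k).eval a / (ascPochhammer ℂ k).eval b

@[simp] lemma pochRatio_zero (a b : ℂ) : pochRatio a b 0 = 1 := by simp [pochRatio]

lemma pochRatio_succ (a b : ℂ) (k : ℕ) :
    pochRatio a b (k + 1) = pochRatio a b k * ((a + k) / (b + k)) := by
  simp only [pochRatio, ascPochhammer_succ_eval]
  rw [mul_div_mul_comm]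

lemma pochRatio_succ' (a b : ℂ) (k : ℕ) :
    pochRatio a b (k + 1) = a / b * pochRatio (a + 1) (b + 1) k := by
  induction k with
  | zero => simp [pochRatio_succ]
  | succ k ih =>
    rw [pochRatio_succ, ih, pochRatio_succ]
    push_cast
    ring

lemma pochRatio_add_one_left {a : ℂ} (ha : a ≠ 0) (b : ℂ) (k : ℕ) :
    pochRatio (a + 1) b k = pochRatio a b k * ((a + k) / a) := by
  induction k with
  | zero => simp [ha]
  | succ k ih =>
    rw [pochRatio_succ, ih, pochRatio_succ]
    push_cast
    ring

lemma pochRatio_add_one_right (a : ℂ) {b : ℂ} (hb : ∀ k : ℕ, b ≠ -k) (k : ℕ) :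
    pochRatio a (b + 1) k = pochRatio a b k * (b / (b + k)) := by
  have hb0 := ne_zero_of_ne_neg_natCast hb
  induction k with
  | zero => simp [hb0]
  | succ k ih =>
    have h1 := add_natCast_ne_zero hb k
    have h2 := add_natCast_ne_zero hb (k + 1)
    rw [pochRatio_succ, ih, pochRatio_succ]
    push_cast at h2 ⊢
    rw [add_right_comm b 1, add_assoc b]
    field_simp

lemma pochRatio_sub_succ (a : ℂ) {b : ℂ} (hb : ∀ k : ℕ, b ≠ -k) (k : ℕ) :
    pochRatio a b k - pochRatio a b (k + 1) = (b - a) / b * pochRatio a (b + 1) k := by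
  have hb0 := ne_zero_of_ne_neg_natCast hb
  have h1 := add_natCast_ne_zero hb k
  rw [pochRatio_succ, pochRatio_add_one_right a hb]
  field_simp
  ring

lemma pochRatio_add_one_right_sub (a : ℂ) {b : ℂ} (hb : ∀ k : ℕ, b ≠ -k) (k : ℕ) :
    pochRatio a (b + 1) k - pochRatio a b k = -(k / b) * pochRatio a (b + 1) k := by
  have hb0 := ne_zero_of_ne_neg_natCast hb
  have h1 := add_natCast_ne_zero hb k
  rw [pochRatio_add_one_right a hb]
  field_simp
  ring

lemma pochRatio_add_one_add_one_sub {a b : ℂ} (ha : a ≠ 0) (hb : ∀ k : ℕ, b ≠ -k) (k : ℕ) :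
    pochRatio (a + 1) (b + 1) k - pochRatio a b k
      = (b - a) / (a * b) * k * pochRatio a (b + 1) k := by
  have hb0 := ne_zero_of_ne_neg_natCast hb
  have h1 := add_natCast_ne_zero hb k
  rw [pochRatio_add_one_left ha, pochRatio_add_one_right a hb]
  field_simp
  ring

lemma Gamma_add_natCast_div {a b : ℂ} (ha : ∀ k : ℕ, a ≠ -k) (hb : ∀ k : ℕ, b ≠ -k) (k : ℕ) :
    Complex.Gamma (a + k) / Complex.Gamma (b + k)
      = Complex.Gamma a / Complex.Gamma b * pochRatio a b k := by
  induction k with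
  | zero => simp
  | succ k ih =>
    have h1 := add_natCast_ne_zero hb k
    have h2 := add_natCast_ne_zero ha k
    push_cast
    rw [← add_assoc, ← add_assoc, Complex.Gamma_add_one _ h1, Complex.Gamma_add_one _ h2,
      pochRatio_succ, mul_div_mul_comm, ih]
    ring

lemma GammaSeq_div_GammaSeq {a b : ℂ} (ha : ∀ k : ℕ, a ≠ -k) (hb : ∀ k : ℕ, b ≠ -k) {n : ℕ}
    (hn : n ≠ 0) : Complex.GammaSeq b n / Complex.GammaSeq a n
      = (n : ℂ) ^ (b - a) * pochRatio a b (n + 1) := by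
  have hp : ∀ x : ℂ, (ascPochhammer ℂ (n + 1)).eval x = ∏ j ∈ Finset.range (n + 1), (x + j) := by
    intro x
    induction n + 1 with
    | zero => simp
    | succ k ih => rw [ascPochhammer_succ_eval, ih, Finset.prod_range_succ]
  have hn' : (n : ℂ) ≠ 0 := by exact_mod_cast hn
  have h1 : ∏ j ∈ Finset.range (n + 1), (a + (j : ℂ)) ≠ 0 :=
    Finset.prod_ne_zero_iff.2 fun k _ => add_natCast_ne_zero ha k
  have h2 : ∏ j ∈ Finset.range (n + 1), (b + (j : ℂ)) ≠ 0 :=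
    Finset.prod_ne_zero_iff.2 fun k _ => add_natCast_ne_zero hb k
  have h3 : (n : ℂ) ^ a ≠ 0 := by simp [Complex.cpow_eq_zero_iff, hn']
  have h4 : (n.factorial : ℂ) ≠ 0 := by exact_mod_cast n.factorial_ne_zero
  rw [Complex.GammaSeq, Complex.GammaSeq, pochRatio, hp, hp, Complex.cpow_sub _ _ hn']
  field_simp

/-- Euler's limits for Γ(b) and Γ(a) have quotient n^(b-a) (a)ₙ₊₁/(b)ₙ₊₁, so this converges. The
factor (b+n)/(a+n) → 1 lowers the index to n. -/
lemma isBigO_pochRatio {a b : ℂ} (ha : ∀ k : ℕ, a ≠ -k) (hb : ∀ k : ℕ, b ≠ -k) :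
    (fun n : ℕ => pochRatio a b n) =O[atTop] fun n : ℕ => (n : ℝ) ^ (a - b).re := by
  have hG := (Complex.GammaSeq_tendsto_Gamma b).div (Complex.GammaSeq_tendsto_Gamma a)
    (Complex.Gamma_ne_zero ha)
  have hq : Tendsto (fun n : ℕ => (b + n) / (a + n)) atTop (𝓝 1) := by
    have := (tendsto_const_nhds (x := (1 : ℂ))).add
      ((tendsto_inv_add_natCast a).const_mul (b - a))
    rw [mul_zero, add_zero] at this
    refine this.congr fun n => ?_
    have := add_natCast_ne_zero ha n
    field_simp
    ring
  have h := (hG.mul hq).isBigO_one ℝ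
  have h2 := h.norm_left.mul (isBigO_refl (fun n : ℕ => (n : ℝ) ^ (a - b).re) atTop)
  refine IsBigO.of_norm_left (h2.congr' ?_ (Eventually.of_forall fun n => by simp))
  filter_upwards [eventually_gt_atTop 0] with n hn
  have h1 := add_natCast_ne_zero ha n
  have h1' := add_natCast_ne_zero hb n
  have hn0 : (0 : ℝ) < n := by exact_mod_cast hn
  have e : (n : ℂ) ^ (b - a) * pochRatio a b (n + 1) * ((b + n) / (a + n))
      = (n : ℂ) ^ (b - a) * pochRatio a b n := by
    rw [pochRatio_succ]
    field_simp
  rw [Pi.div_apply, GammaSeq_div_GammaSeq ha hb hn.ne', e, norm_mul,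
    Complex.norm_natCast_cpow_of_pos hn, mul_right_comm, ← Real.rpow_add hn0]
  simp

lemma isBigO_pochRatio_succ {a b : ℂ} (ha : ∀ k : ℕ, a ≠ -k) (hb : ∀ k : ℕ, b ≠ -k) :
    (fun n : ℕ => pochRatio a b (n + 1)) =O[atTop] fun n : ℕ => (n : ℝ) ^ (a - b).re := by
  have h := (isBigO_pochRatio (ne_neg_natCast_add_one ha)
    (ne_neg_natCast_add_one hb)).const_mul_left (a / b)
  rw [add_sub_add_right_eq_sub] at h
  exact h.congr_left fun n => (pochRatio_succ' a b n).symm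

/-! ### Power bounds, harmonic numbers and ψ. -/

lemma isBigO_rpow_mul_rpow {f g : ℕ → ℂ} {r s : ℝ} (hf : f =O[atTop] fun n : ℕ => (n : ℝ) ^ r)
    (hg : g =O[atTop] fun n : ℕ => (n : ℝ) ^ s) :
    (fun n => f n * g n) =O[atTop] fun n : ℕ => (n : ℝ) ^ (r + s) := by
  refine (hf.mul hg).congr' EventuallyEq.rfl ?_
  filter_upwards [eventually_gt_atTop 0] with n hn
  rw [Real.rpow_add (by exact_mod_cast hn)]

lemma summable_of_isBigO_rpow {f : ℕ → ℂ} {r : ℝ} (hf : f =O[atTop] fun n : ℕ => (n : ℝ) ^ r)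
    (hr : r < -1) : Summable f :=
  summable_of_isBigO_nat (Real.summable_nat_rpow.2 hr) hf

lemma tendsto_zero_of_isBigO_rpow {f : ℕ → ℂ} {r : ℝ}
    (hf : f =O[atTop] fun n : ℕ => (n : ℝ) ^ r) (hr : r < 0) : Tendsto f atTop (𝓝 0) := by
  refine hf.trans_tendsto ?_
  have := (tendsto_rpow_neg_atTop (neg_pos.2 hr)).comp (tendsto_natCast_atTop_atTop (R := ℝ))
  simpa [Function.comp_def] using this

lemma isBigO_rpow_neg_one {f : ℕ → ℂ} (hf : f =O[atTop] fun n : ℕ => (n : ℝ)⁻¹) :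
    f =O[atTop] fun n : ℕ => (n : ℝ) ^ (-1 : ℝ) := by
  simpa only [Real.rpow_neg_one] using hf

lemma isBigO_inv_natCast_add_one :
    (fun n : ℕ => ((n : ℂ) + 1)⁻¹) =O[atTop] fun n : ℕ => (n : ℝ) ^ (-1 : ℝ) :=
  isBigO_rpow_neg_one ((isBigO_inv_add_natCast 1).congr_left fun n => by rw [add_comm])

lemma isBigO_inv_natCast_add_one_sq :
    (fun n : ℕ => (((n : ℂ) + 1) ^ 2)⁻¹) =O[atTop] fun n : ℕ => (n : ℝ) ^ (-2 : ℝ) := by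
  have := isBigO_rpow_mul_rpow isBigO_inv_natCast_add_one isBigO_inv_natCast_add_one
  rw [show (-1 : ℝ) + -1 = -2 by norm_num] at this
  refine this.congr_left fun n => ?_
  rw [sq, mul_inv]

lemma norm_natCast_add_one (k : ℕ) : ‖(k : ℂ) + 1‖ = k + 1 := by
  have := Complex.norm_natCast (k + 1)
  push_cast at this
  exact this

lemma norm_harmonic (n : ℕ) : ‖((harmonic n : ℚ) : ℂ)‖ = ((harmonic n : ℚ) : ℝ) := by
  have h : ((harmonic n : ℚ) : ℂ) = (((harmonic n : ℚ) : ℝ) : ℂ) := by push_cast; rfl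
  rw [h, Complex.norm_real, Real.norm_of_nonneg]
  exact_mod_cast Finset.sum_nonneg fun i _ => by positivity

lemma norm_harmonic_le (n : ℕ) : ‖((harmonic n : ℚ) : ℂ)‖ ≤ n := by
  rw [norm_harmonic]
  have : harmonic n ≤ n := by
    refine (Finset.sum_le_card_nsmul _ _ 1 fun i _ => ?_).trans_eq (by simp)
    exact inv_le_one_of_one_le₀ (by exact_mod_cast i.succ_pos)
  exact_mod_cast this

lemma isBigO_const_rpow {E : Type*} [NormedAddCommGroup E] (c : E) {ε : ℝ} (hε : 0 < ε) :
    (fun _ : ℝ => c) =O[atTop] fun x : ℝ => x ^ ε :=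
  (isLittleO_const_left.2 (Or.inr (tendsto_norm_atTop_atTop.comp (tendsto_rpow_atTop hε)))).isBigO

lemma isBigO_harmonic {ε : ℝ} (hε : 0 < ε) :
    (fun n : ℕ => ((harmonic n : ℚ) : ℂ)) =O[atTop] fun n : ℕ => (n : ℝ) ^ ε := by
  have h1 : (fun n : ℕ => 1 + Real.log n) =O[atTop] fun n : ℕ => (n : ℝ) ^ ε := by
    have h := (isBigO_const_rpow (1 : ℝ) hε).add (isLittleO_log_rpow_atTop hε).isBigO
    exact h.comp_tendsto tendsto_natCast_atTop_atTop
  refine IsBigO.trans (IsBigO.of_bound 1 (Eventually.of_forall fun n => ?_)) h1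
  rw [norm_harmonic, one_mul]
  exact (harmonic_le_one_add_log n).trans (le_abs_self _)

lemma digamma_one_add_natCast (n : ℕ) :
    Complex.digamma (1 + n) = ((harmonic n : ℚ) : ℂ) - Real.eulerMascheroniConstant := by
  rw [digamma_add_natCast (ne_neg_natCast_of_re_pos (by simp)), Complex.digamma_one, harmonic]
  push_cast
  rw [neg_add_eq_sub]
  congr 1
  exact Finset.sum_congr rfl fun i _ => by rw [add_comm]

lemma isBigO_digamma_one_add_natCast {ε : ℝ} (hε : 0 < ε) :
    (fun n : ℕ => Complex.digamma (1 + n)) =O[atTop] fun n : ℕ => (n : ℝ) ^ ε := by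
  simp only [digamma_one_add_natCast]
  refine (isBigO_harmonic hε).sub ?_
  exact (isBigO_const_rpow _ hε).comp_tendsto tendsto_natCast_atTop_atTop

lemma isBigO_digamma_add_natCast {z : ℂ} (hz : ∀ k : ℕ, z ≠ -k) {ε : ℝ} (hε : 0 < ε) :
    (fun n : ℕ => Complex.digamma (z + n)) =O[atTop] fun n : ℕ => (n : ℝ) ^ ε := by
  have h1 : (fun n : ℕ => (n : ℝ)⁻¹) =O[atTop] fun n : ℕ => (n : ℝ) ^ ε := by
    have : (fun x : ℝ => x ^ (-1 : ℝ)) =O[atTop] fun x : ℝ => x ^ ε := by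
      refine IsBigO.of_bound 1 ?_
      filter_upwards [eventually_ge_atTop 1] with x hx
      rw [one_mul, Real.norm_of_nonneg (by positivity), Real.norm_of_nonneg (by positivity)]
      exact Real.rpow_le_rpow_of_exponent_le hx (by linarith)
    simpa [Function.comp_def, Real.rpow_neg_one] using this.comp_tendsto tendsto_natCast_atTop_atTop
  refine (((isBigO_digamma_sub hz (w := 1) (ne_neg_natCast_of_re_pos (by simp))).trans h1).add
    (isBigO_digamma_one_add_natCast hε)).congr_left fun n => by ring

/-! ### Sums weighted by 1/k and Hₖ₋₁/k, evaluated by shifting b. -/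

/-- For j ≥ 1 the factor |a+j|/|b+j| is at most (A+j)/(A+j+2) with A = ‖a‖, and these telescope to
order 1/k². The factor j = 0 supplies 1/Re b, which forces the sums to 0 as b moves right. -/
lemma norm_pochRatio_succ_le {a b : ℂ} (h : ‖a‖ + 2 ≤ b.re) (k : ℕ) :
    ‖pochRatio a b (k + 1)‖ ≤
      ‖a‖ * (‖a‖ + 1) * (‖a‖ + 2) / (b.re * ((‖a‖ + k + 1) * (‖a‖ + k + 2))) := by
  have hA := norm_nonneg a
  have hX : 0 < b.re := by linarith
  induction k with
  | zero =>
    rw [pochRatio_succ, pochRatio_zero, one_mul, norm_div]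
    simp only [CharP.cast_eq_zero, add_zero]
    calc ‖a‖ / ‖b‖ ≤ ‖a‖ / b.re := by gcongr; exact Complex.re_le_norm b
      _ = _ := by field_simp
  | succ k ih =>
    rw [pochRatio_succ, norm_mul, norm_div]
    have h1 : ‖a + (k + 1 : ℕ)‖ ≤ ‖a‖ + k + 1 := by
      refine (norm_add_le _ _).trans ?_
      rw [Complex.norm_natCast]
      push_cast
      linarith
    have h2 : ‖a‖ + k + 3 ≤ ‖b + (k + 1 : ℕ)‖ := by
      refine le_trans ?_ (Complex.re_le_norm _)
      simp
      linarith
    calc _ ≤ ‖a‖ * (‖a‖ + 1) * (‖a‖ + 2) / (b.re * ((‖a‖ + k + 1) * (‖a‖ + k + 2)))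
          * ((‖a‖ + k + 1) / (‖a‖ + k + 3)) := by gcongr
      _ = _ := by push_cast; field_simp; ring

lemma tendsto_tsum_pochRatio_zero (a b : ℂ) {g : ℕ → ℂ} (hg : ∀ k, ‖g k‖ ≤ 1) :
    Tendsto (fun n : ℕ => ∑' k, pochRatio a (b + n) (k + 1) * g k) atTop (𝓝 0) := by
  set K := ‖a‖ * (‖a‖ + 1) * (‖a‖ + 2) with hK
  have hK0 : 0 ≤ K := by positivity
  set S := ∑' k : ℕ, 1 / ((k : ℝ) + 1) ^ 2
  have hx : Tendsto (fun n : ℕ => b.re + (n : ℝ)) atTop atTop :=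
    tendsto_atTop_add_const_left _ _ tendsto_natCast_atTop_atTop
  have hlim : Tendsto (fun n : ℕ => K / (b.re + n) * S) atTop (𝓝 (0 * S)) :=
    (tendsto_const_nhds.div_atTop hx).mul_const _
  rw [zero_mul] at hlim
  refine squeeze_zero_norm' ?_ hlim
  filter_upwards [hx.eventually_ge_atTop (‖a‖ + 2)] with n hn
  have hA := norm_nonneg a
  have hre : (b + n).re = b.re + n := by simp
  refine tsum_of_norm_bounded (summable_one_div_succ_sq.hasSum.mul_left _) fun k => ?_
  have h1 := norm_pochRatio_succ_le (a := a) (b := b + n) (by rw [hre]; exact hn) k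
  rw [hre, ← hK] at h1
  have hX : 0 < b.re + n := by linarith
  calc ‖pochRatio a (b + n) (k + 1) * g k‖ ≤ ‖pochRatio a (b + n) (k + 1)‖ * 1 := by
        rw [norm_mul]; gcongr; exact hg k
    _ ≤ K / ((b.re + n) * ((k + 1) * (k + 1))) := by
        rw [mul_one]
        refine h1.trans ?_
        gcongr <;> linarith
    _ = _ := by field_simp

lemma norm_inv_natCast_add_one_le (k : ℕ) : ‖((k : ℂ) + 1)⁻¹‖ ≤ 1 := by
  rw [norm_inv, norm_natCast_add_one]
  exact inv_le_one_of_one_le₀ (by linarith [(k.cast_nonneg : (0 : ℝ) ≤ k)])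

lemma eq_zero_of_succ_eq_of_tendsto {f : ℕ → ℂ} (h : ∀ n, f (n + 1) = f n)
    (hf : Tendsto f atTop (𝓝 0)) : f 0 = 0 := by
  have : ∀ n, f n = f 0 := fun n => by
    induction n with
    | zero => rfl
    | succ n ih => rw [h, ih]
  exact tendsto_nhds_unique (tendsto_const_nhds.congr fun n => (this n).symm) hf

lemma hasSum_pochRatio {a b : ℂ} (ha : ∀ k : ℕ, a ≠ -k) (hb : ∀ k : ℕ, b ≠ -k)
    (hab : 0 < (b - a).re) :
    HasSum (fun k => pochRatio a (b + 1) (k + 1)) (a / (b - a)) := by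
  have hba : b - a ≠ 0 := by intro h; rw [h] at hab; simp at hab
  have hb0 := ne_zero_of_ne_neg_natCast hb
  have hs : Summable fun k => pochRatio a (b + 1) (k + 1) :=
    summable_of_isBigO_rpow (isBigO_pochRatio_succ ha (ne_neg_natCast_add_one hb))
      (by simp at hab ⊢; linarith)
  have h0 := tendsto_zero_of_isBigO_rpow (isBigO_pochRatio_succ ha hb)
    (by simp at hab ⊢; linarith)
  have hpart : ∀ n, ∑ k ∈ Finset.range n, pochRatio a (b + 1) (k + 1)
      = b / (b - a) * (pochRatio a b 1 - pochRatio a b (n + 1)) := by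
    intro n
    rw [← Finset.sum_range_sub' (fun k => pochRatio a b (k + 1)), Finset.mul_sum]
    refine Finset.sum_congr rfl fun k _ => ?_
    rw [pochRatio_sub_succ a hb]
    field_simp
  have hl : Tendsto (fun n => ∑ k ∈ Finset.range n, pochRatio a (b + 1) (k + 1)) atTop
      (𝓝 (a / (b - a))) := by
    simp only [hpart]
    have := (h0.const_sub (pochRatio a b 1)).const_mul (b / (b - a))
    convert this using 2
    rw [pochRatio_succ]
    simp
    field_simp
  rw [← tendsto_nhds_unique hs.hasSum.tendsto_sum_nat hl]
  exact hs.hasSum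

lemma summable_pochRatio_mul {a b : ℂ} (ha : ∀ k : ℕ, a ≠ -k) (hb : ∀ k : ℕ, b ≠ -k)
    {f : ℕ → ℂ} {s : ℝ} (hf : f =O[atTop] fun n : ℕ => (n : ℝ) ^ s) (hs : s + 1 < (b - a).re) :
    Summable fun k => pochRatio a b (k + 1) * f k :=
  summable_of_isBigO_rpow (isBigO_rpow_mul_rpow (isBigO_pochRatio_succ ha hb) hf)
    (by simp at hs ⊢; linarith)

/-- `∑ₖ (a)ₖ / ((b)ₖ k) = ψ(b) - ψ(b - a)`. -/
lemma hasSum_pochRatio_mul_inv {a b : ℂ} (ha : ∀ k : ℕ, a ≠ -k) (hb : ∀ k : ℕ, b ≠ -k)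
    (hab : 0 < (b - a).re) :
    HasSum (fun k : ℕ => pochRatio a b (k + 1) * ((k : ℂ) + 1)⁻¹)
      (Complex.digamma b - Complex.digamma (b - a)) := by
  have hs : ∀ b : ℂ, (∀ k : ℕ, b ≠ -k) → 0 < (b - a).re →
      Summable fun k : ℕ => pochRatio a b (k + 1) * ((k : ℂ) + 1)⁻¹ := fun b hb hab =>
    summable_pochRatio_mul ha hb isBigO_inv_natCast_add_one (by linarith)
  have hshift : ∀ n : ℕ, 0 < (b + n - a).re := fun n => by
    have : (0 : ℝ) ≤ n := n.cast_nonneg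
    simp at hab ⊢
    linarith
  have hstep : ∀ b : ℂ, (∀ k : ℕ, b ≠ -k) → 0 < (b - a).re →
      (∑' k : ℕ, pochRatio a (b + 1) (k + 1) * ((k : ℂ) + 1)⁻¹)
        - (Complex.digamma (b + 1) - Complex.digamma (b + 1 - a))
      = (∑' k : ℕ, pochRatio a b (k + 1) * ((k : ℂ) + 1)⁻¹)
        - (Complex.digamma b - Complex.digamma (b - a)) := by
    intro b hb hab
    have hb0 := ne_zero_of_ne_neg_natCast hb
    have hba : b - a ≠ 0 := by intro h; rw [h] at hab; simp at hab
    -- The shift in b multiplies the summand by -k/b, cancelling the weight 1/k and leaving the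
    -- telescoping sum `hasSum_pochRatio`.
    have h1 : (∑' k : ℕ, pochRatio a (b + 1) (k + 1) * ((k : ℂ) + 1)⁻¹)
        - (∑' k : ℕ, pochRatio a b (k + 1) * ((k : ℂ) + 1)⁻¹) = -(1 / b) * (a / (b - a)) := by
      rw [← (hs (b + 1) (ne_neg_natCast_add_one hb) (by simp at hab ⊢; linarith)).tsum_sub
        (hs b hb hab), ← (hasSum_pochRatio ha hb hab).tsum_eq, ← tsum_mul_left]
      refine tsum_congr fun k => ?_
      have hk : (k : ℂ) + 1 ≠ 0 := Nat.cast_add_one_ne_zero k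
      rw [← sub_mul, pochRatio_add_one_right_sub a hb]
      push_cast
      field_simp
    rw [add_sub_right_comm, Complex.digamma_apply_add_one b hb,
      Complex.digamma_apply_add_one _ (ne_neg_natCast_of_re_pos hab)]
    rw [sub_eq_iff_eq_add] at h1
    rw [h1]
    field_simp
    ring
  have hlim : Tendsto (fun n : ℕ => (∑' k : ℕ, pochRatio a (b + n) (k + 1) * ((k : ℂ) + 1)⁻¹)
      - (Complex.digamma (b + n) - Complex.digamma (b + n - a))) atTop (𝓝 0) := by
    have := (tendsto_tsum_pochRatio_zero a b norm_inv_natCast_add_one_le).sub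
      (tendsto_digamma_sub b (b - a))
    rw [sub_zero] at this
    exact this.congr fun n => by rw [add_sub_right_comm]
  have h0 := eq_zero_of_succ_eq_of_tendsto (fun n => by
    have := hstep (b + n) (ne_neg_natCast_add hb n) (hshift n)
    push_cast
    rw [← add_assoc, this]) hlim
  rw [Nat.cast_zero, add_zero, sub_eq_zero] at h0
  rw [← h0]
  exact (hs b hb hab).hasSum

lemma hasSum_pochRatio_mul_harmonic {a b : ℂ} (ha : ∀ k : ℕ, a ≠ -k) (hb : ∀ k : ℕ, b ≠ -k)
    (hab : 0 < (b - a).re) :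
    HasSum (fun k : ℕ => pochRatio a (b + 1) (k + 1) * ((harmonic k : ℚ) : ℂ))
      (a / (b - a) * (Complex.digamma (b + 1) - Complex.digamma (b - a))) := by
  have hba : b - a ≠ 0 := by intro h; rw [h] at hab; simp at hab
  have hb0 := ne_zero_of_ne_neg_natCast hb
  have hs : Summable fun k : ℕ => pochRatio a (b + 1) (k + 1) * ((harmonic k : ℚ) : ℂ) :=
    summable_pochRatio_mul ha (ne_neg_natCast_add_one hb) (isBigO_harmonic (half_pos hab))
      (by simp at hab ⊢; linarith)
  have h0 : Tendsto (fun n : ℕ => pochRatio a b (n + 1) * ((harmonic n : ℚ) : ℂ)) atTop (𝓝 0) :=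
    tendsto_zero_of_isBigO_rpow (isBigO_rpow_mul_rpow (isBigO_pochRatio_succ ha hb)
      (isBigO_harmonic (half_pos hab))) (by simp at hab ⊢; linarith)
  have hp := hasSum_pochRatio_mul_inv (ne_neg_natCast_add_one ha) (ne_neg_natCast_add_one hb)
    (by simpa using hab)
  rw [add_sub_add_right_eq_sub] at hp
  -- Summation by parts: the increments 1/k of the harmonic numbers turn this into the 1/k sum with
  -- parameters (a+1, b+1).
  have hpart : ∀ n : ℕ,
      ∑ k ∈ Finset.range n, pochRatio a (b + 1) (k + 1) * ((harmonic k : ℚ) : ℂ)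
      = a / (b - a) * ∑ k ∈ Finset.range n, pochRatio (a + 1) (b + 1) (k + 1) * ((k : ℂ) + 1)⁻¹
        - b / (b - a) * (pochRatio a b (n + 1) * ((harmonic n : ℚ) : ℂ)) := by
    intro n
    induction n with
    | zero => simp
    | succ n ih =>
      have h1 := pochRatio_sub_succ a hb (n + 1)
      have h2 := pochRatio_succ' a b (n + 1)
      have h3 : pochRatio a (b + 1) (n + 1)
          = b / (b - a) * (pochRatio a b (n + 1) - a / b * pochRatio (a + 1) (b + 1) (n + 1)) := by
        rw [← h2, h1]
        field_simp
      have hn : (n : ℂ) + 1 ≠ 0 := Nat.cast_add_one_ne_zero n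
      rw [Finset.sum_range_succ, Finset.sum_range_succ, ih, h3, h2, harmonic_succ]
      push_cast
      field_simp
      ring
  have hl := (hp.tendsto_sum_nat.const_mul (a / (b - a))).sub (h0.const_mul (b / (b - a)))
  rw [mul_zero, sub_zero] at hl
  rw [← tendsto_nhds_unique hs.hasSum.tendsto_sum_nat (hl.congr fun n => (hpart n).symm)]
  exact hs.hasSum

lemma norm_harmonic_mul_inv_le (k : ℕ) : ‖((harmonic k : ℚ) : ℂ) * ((k : ℂ) + 1)⁻¹‖ ≤ 1 := by
  rw [norm_mul, norm_inv, norm_natCast_add_one, ← div_eq_mul_inv, div_le_one (by positivity)]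
  exact (norm_harmonic_le k).trans (by linarith)

/-- `∑ₖ (a)ₖ Hₖ₋₁ / ((b)ₖ k) = ((ψ(b) - ψ(b - a))² + ψ'(b - a) - ψ'(b)) / 2`. -/
lemma hasSum_pochRatio_mul_harmonic_mul_inv {a b : ℂ} (ha : ∀ k : ℕ, a ≠ -k)
    (hb : ∀ k : ℕ, b ≠ -k) (hab : 0 < (b - a).re) :
    HasSum (fun k : ℕ => pochRatio a b (k + 1) * (((harmonic k : ℚ) : ℂ) * ((k : ℂ) + 1)⁻¹))
      (1 / 2 * ((Complex.digamma b - Complex.digamma (b - a)) ^ 2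
        + (trigamma (b - a) - trigamma b))) := by
  have hs : ∀ b : ℂ, (∀ k : ℕ, b ≠ -k) → 0 < (b - a).re → Summable fun k : ℕ =>
      pochRatio a b (k + 1) * (((harmonic k : ℚ) : ℂ) * ((k : ℂ) + 1)⁻¹) := fun b hb hab =>
    summable_pochRatio_mul ha hb
      (isBigO_rpow_mul_rpow (isBigO_harmonic (half_pos hab)) isBigO_inv_natCast_add_one)
      (by linarith)
  have hshift : ∀ n : ℕ, 0 < (b + n - a).re := fun n => by
    have : (0 : ℝ) ≤ n := n.cast_nonneg
    simp at hab ⊢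
    linarith
  have hstep : ∀ b : ℂ, (∀ k : ℕ, b ≠ -k) → 0 < (b - a).re →
      (∑' k : ℕ, pochRatio a (b + 1) (k + 1) * (((harmonic k : ℚ) : ℂ) * ((k : ℂ) + 1)⁻¹))
        - 1 / 2 * ((Complex.digamma (b + 1) - Complex.digamma (b + 1 - a)) ^ 2
          + (trigamma (b + 1 - a) - trigamma (b + 1)))
      = (∑' k : ℕ, pochRatio a b (k + 1) * (((harmonic k : ℚ) : ℂ) * ((k : ℂ) + 1)⁻¹))
        - 1 / 2 * ((Complex.digamma b - Complex.digamma (b - a)) ^ 2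
          + (trigamma (b - a) - trigamma b)) := by
    intro b hb hab
    have hb0 := ne_zero_of_ne_neg_natCast hb
    have hba : b - a ≠ 0 := by intro h; rw [h] at hab; simp at hab
    -- Again the factor -k/b cancels 1/k, now leaving `hasSum_pochRatio_mul_harmonic`.
    have h1 : (∑' k : ℕ, pochRatio a (b + 1) (k + 1) * (((harmonic k : ℚ) : ℂ) * ((k : ℂ) + 1)⁻¹))
        - (∑' k : ℕ, pochRatio a b (k + 1) * (((harmonic k : ℚ) : ℂ) * ((k : ℂ) + 1)⁻¹))
        = -(1 / b) * (a / (b - a) * (Complex.digamma (b + 1) - Complex.digamma (b - a))) := by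
      rw [← (hs (b + 1) (ne_neg_natCast_add_one hb) (by simp at hab ⊢; linarith)).tsum_sub
        (hs b hb hab), ← (hasSum_pochRatio_mul_harmonic ha hb hab).tsum_eq, ← tsum_mul_left]
      refine tsum_congr fun k => ?_
      have hk : (k : ℂ) + 1 ≠ 0 := Nat.cast_add_one_ne_zero k
      rw [← sub_mul, pochRatio_add_one_right_sub a hb]
      push_cast
      field_simp
    have hN := ne_neg_natCast_of_re_pos hab
    rw [add_sub_right_comm, trigamma_add_one hN, trigamma_add_one hb,
      Complex.digamma_apply_add_one _ hN]
    rw [sub_eq_iff_eq_add, Complex.digamma_apply_add_one b hb] at h1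
    rw [Complex.digamma_apply_add_one b hb, h1]
    field_simp
    ring
  have hlim : Tendsto (fun n : ℕ =>
      (∑' k : ℕ, pochRatio a (b + n) (k + 1) * (((harmonic k : ℚ) : ℂ) * ((k : ℂ) + 1)⁻¹))
        - 1 / 2 * ((Complex.digamma (b + n) - Complex.digamma (b + n - a)) ^ 2
          + (trigamma (b + n - a) - trigamma (b + n)))) atTop (𝓝 0) := by
    have := (tendsto_tsum_pochRatio_zero a b norm_harmonic_mul_inv_le).sub
      ((((tendsto_digamma_sub b (b - a)).pow 2).add
        ((tendsto_trigamma_add_natCast (b - a)).sub (tendsto_trigamma_add_natCast b))).const_mul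
          (1 / 2))
    simp only [ne_eq, OfNat.ofNat_ne_zero, not_false_eq_true, zero_pow, sub_zero, add_zero,
      mul_zero] at this
    exact this.congr fun n => by rw [add_sub_right_comm]
  have h0 := eq_zero_of_succ_eq_of_tendsto (fun n => by
    have := hstep (b + n) (ne_neg_natCast_add hb n) (hshift n)
    push_cast
    rw [← add_assoc, this]) hlim
  rw [Nat.cast_zero, add_zero, sub_eq_zero] at h0
  rw [← h0]
  exact (hs b hb hab).hasSum

/-! ### The 1/k² sum and its reflection formula. -/

/-- `∑ₖ (a)ₖ / ((b)ₖ k²)`. -/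
noncomputable def pochSumSq (a b : ℂ) : ℂ := ∑' k : ℕ, pochRatio a b (k + 1) * (((k : ℂ) + 1) ^ 2)⁻¹

lemma summable_pochRatio_mul_inv_sq {a b : ℂ} (ha : ∀ k : ℕ, a ≠ -k) (hb : ∀ k : ℕ, b ≠ -k)
    (hab : -1 < (b - a).re) :
    Summable fun k : ℕ => pochRatio a b (k + 1) * (((k : ℂ) + 1) ^ 2)⁻¹ :=
  summable_pochRatio_mul ha hb isBigO_inv_natCast_add_one_sq (by linarith)

lemma pochSumSq_add_one_right_sub {a b : ℂ} (ha : ∀ k : ℕ, a ≠ -k) (hb : ∀ k : ℕ, b ≠ -k)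
    (hab : -1 < (b - a).re) : pochSumSq a (b + 1) - pochSumSq a b
      = -(1 / b) * (Complex.digamma (b + 1) - Complex.digamma (b + 1 - a)) := by
  have hb1 := ne_neg_natCast_add_one hb
  have hb0 := ne_zero_of_ne_neg_natCast hb
  have hab1 : 0 < (b + 1 - a).re := by simp at hab ⊢; linarith
  rw [pochSumSq, pochSumSq, ← (summable_pochRatio_mul_inv_sq ha hb1 (by linarith)).tsum_sub
    (summable_pochRatio_mul_inv_sq ha hb hab), ← (hasSum_pochRatio_mul_inv ha hb1 hab1).tsum_eq,
    ← tsum_mul_left]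
  refine tsum_congr fun k => ?_
  have hk : (k : ℂ) + 1 ≠ 0 := Nat.cast_add_one_ne_zero k
  rw [← sub_mul, pochRatio_add_one_right_sub a hb]
  push_cast
  field_simp

lemma pochSumSq_add_one_add_one_sub {a b : ℂ} (ha : ∀ k : ℕ, a ≠ -k) (hb : ∀ k : ℕ, b ≠ -k)
    (hab : -1 < (b - a).re) : pochSumSq (a + 1) (b + 1) - pochSumSq a b
      = (b - a) / (a * b) * (Complex.digamma (b + 1) - Complex.digamma (b + 1 - a)) := by
  have hb1 := ne_neg_natCast_add_one hb
  have ha0 := ne_zero_of_ne_neg_natCast ha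
  have hb0 := ne_zero_of_ne_neg_natCast hb
  have hab1 : 0 < (b + 1 - a).re := by simp at hab ⊢; linarith
  rw [pochSumSq, pochSumSq, ← (summable_pochRatio_mul_inv_sq (ne_neg_natCast_add_one ha) hb1
    (by simpa using hab)).tsum_sub (summable_pochRatio_mul_inv_sq ha hb hab),
    ← (hasSum_pochRatio_mul_inv ha hb1 hab1).tsum_eq, ← tsum_mul_left]
  refine tsum_congr fun k => ?_
  have hk : (k : ℂ) + 1 ≠ 0 := Nat.cast_add_one_ne_zero k
  rw [← sub_mul, pochRatio_add_one_add_one_sub ha0 hb]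
  push_cast
  field_simp

/-- The defect of the reflection formula `pochSumSq_add_pochSumSq`. -/
noncomputable def reflectionDefect (u v : ℂ) : ℂ :=
  pochSumSq u (u + v) + pochSumSq v (u + v) - ((Real.pi : ℂ) ^ 2 / 6 + trigamma (u + v)
    - (Complex.digamma u - Complex.digamma (u + v)) * (Complex.digamma v - Complex.digamma (u + v)))

lemma reflectionDefect_comm (u v : ℂ) : reflectionDefect u v = reflectionDefect v u := by
  rw [reflectionDefect, reflectionDefect, add_comm v u]
  ring

/-- Under u → u+1 the first sum has both parameters shifted, the second only its lower one. Each
change is a 1/k sum, hence a difference of ψ values, and the recurrences give the same change on the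
closed-form side. -/
lemma reflectionDefect_add_one_left {u v : ℂ} (hu : ∀ k : ℕ, u ≠ -k) (hv : ∀ k : ℕ, v ≠ -k)
    (huv : ∀ k : ℕ, u + v ≠ -k) (hu1 : -1 < u.re) (hv1 : -1 < v.re) :
    reflectionDefect (u + 1) v = reflectionDefect u v := by
  have h1 := pochSumSq_add_one_add_one_sub hu huv (by simpa using hv1)
  have h2 := pochSumSq_add_one_right_sub hv huv (by simpa using hu1)
  have e1 : u + v + 1 - u = v + 1 := by ring
  have e2 : u + v + 1 - v = u + 1 := by ring
  have e3 : u + v - u = v := by ring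
  have hu0 := ne_zero_of_ne_neg_natCast hu
  have hv0 := ne_zero_of_ne_neg_natCast hv
  have huv0 := ne_zero_of_ne_neg_natCast huv
  rw [e1, e3, sub_eq_iff_eq_add, Complex.digamma_apply_add_one v hv,
    Complex.digamma_apply_add_one _ huv] at h1
  rw [e2, sub_eq_iff_eq_add, Complex.digamma_apply_add_one u hu,
    Complex.digamma_apply_add_one _ huv] at h2
  rw [reflectionDefect, reflectionDefect, add_right_comm u 1 v, h1, h2, trigamma_add_one huv,
    Complex.digamma_apply_add_one u hu, Complex.digamma_apply_add_one _ huv]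
  field_simp
  ring

lemma reflectionDefect_add_natCast_left {u v : ℂ} (hu : ∀ k : ℕ, u ≠ -k) (hv : ∀ k : ℕ, v ≠ -k)
    (huv : ∀ k : ℕ, u + v ≠ -k) (hu1 : -1 < u.re) (hv1 : -1 < v.re) (n : ℕ) :
    reflectionDefect (u + n) v = reflectionDefect u v := by
  induction n with
  | zero => simp
  | succ n ih =>
    have hn : (0 : ℝ) ≤ n := n.cast_nonneg
    rw [← ih, ← reflectionDefect_add_one_left (ne_neg_natCast_add hu n) hv
      (by rw [add_right_comm]; exact ne_neg_natCast_add huv n) (by simp; linarith) hv1]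
    push_cast
    rw [add_assoc]

lemma tendsto_pochRatio_one (u v : ℂ) (k : ℕ) :
    Tendsto (fun n : ℕ => pochRatio (u + n) (u + n + v) k) atTop (𝓝 1) := by
  induction k with
  | zero => simp
  | succ k ih =>
    have hq : Tendsto (fun n : ℕ => (u + n + k) / (u + n + v + k)) atTop (𝓝 1) := by
      have := (tendsto_const_nhds (x := (1 : ℂ))).sub
        ((tendsto_inv_add_natCast (u + v + k)).const_mul v)
      rw [mul_zero, sub_zero] at this
      refine this.congr' ?_
      obtain ⟨N, hN⟩ := exists_re_add_natCast_pos (u + v + k)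
      filter_upwards [eventually_ge_atTop N] with n hn
      have h0 : u + v + k + n ≠ 0 := by
        intro h
        have := hN n hn
        rw [h] at this
        simp at this
      have e : u + n + v + k = u + v + k + n := by ring
      rw [e]
      field_simp
      ring
    have := ih.mul hq
    rw [mul_one] at this
    exact this.congr fun n => (pochRatio_succ _ _ _).symm

/-- For x = u+n+k, |x+v|² - |x|² = 2 Re(x v̄) + |v|². This is nonnegative for all k at once when Re
v · (Re u + n) ≥ |Im v · Im u|, giving the domination for the limit of `pochSumSq`. -/
lemma eventually_norm_pochRatio_le_one (u : ℂ) {v : ℂ} (hv : 0 < v.re) :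
    ∀ᶠ n : ℕ in atTop, ∀ k, ‖pochRatio (u + n) (u + n + v) k‖ ≤ 1 := by
  have ht : Tendsto (fun n : ℕ => v.re * (u.re + n)) atTop atTop :=
    (tendsto_atTop_add_const_left _ _ tendsto_natCast_atTop_atTop).const_mul_atTop hv
  filter_upwards [ht.eventually_ge_atTop |v.im * u.im|] with n hn k
  induction k with
  | zero => simp
  | succ k ih =>
    rw [pochRatio_succ, norm_mul, norm_div]
    refine mul_le_one₀ ih (by positivity) (div_le_one_of_le₀ ?_ (norm_nonneg _))
    rw [← sq_le_sq₀ (norm_nonneg _) (norm_nonneg _), Complex.sq_norm, Complex.sq_norm,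
      Complex.normSq_apply, Complex.normSq_apply]
    simp only [Complex.add_re, Complex.add_im, Complex.natCast_re, Complex.natCast_im]
    have h1 := neg_abs_le (v.im * u.im)
    have h2 : (0 : ℝ) ≤ v.re * k := by positivity
    nlinarith [sq_nonneg v.re, sq_nonneg v.im]

lemma tendsto_pochSumSq (u : ℂ) {v : ℂ} (hv : 0 < v.re) :
    Tendsto (fun n : ℕ => pochSumSq (u + n) (u + n + v)) atTop (𝓝 ((Real.pi : ℂ) ^ 2 / 6)) := by
  have hz : HasSum (fun k : ℕ => (1 : ℂ) * (((k : ℂ) + 1) ^ 2)⁻¹) ((Real.pi : ℂ) ^ 2 / 6) := by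
    have := (hasSum_nat_add_iff' 1).2 hasSum_zeta_two
    have := Complex.hasSum_ofReal.2 this
    simpa using this
  rw [← hz.tsum_eq]
  refine tendsto_tsum_of_dominated_convergence summable_one_div_succ_sq
    (fun k => (tendsto_pochRatio_one u v (k + 1)).mul_const _) ?_
  filter_upwards [eventually_norm_pochRatio_le_one u hv] with n hn k
  rw [norm_mul, norm_inv, norm_pow, norm_natCast_add_one, one_div]
  exact mul_le_of_le_one_left (by positivity) (hn _)

/-- The defect is invariant under u → u+n. As n → ∞ the first sum tends to ζ(2) by dominated
convergence, the second to 0, and the product of ψ differences is O(1/n) · O(n^(1/2)). -/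
lemma reflectionDefect_eq_zero_of_re_pos {u v : ℂ} (hu : 0 < u.re) (hv : 0 < v.re) :
    reflectionDefect u v = 0 := by
  have hu' := ne_neg_natCast_of_re_pos hu
  have hv' := ne_neg_natCast_of_re_pos hv
  have huv' : ∀ k : ℕ, u + v ≠ -k := ne_neg_natCast_of_re_pos (by simp; linarith)
  have e : ∀ n : ℕ, u + n + v = u + v + n := fun n => by ring
  have h1 := tendsto_pochSumSq u hv
  have h2 := tendsto_tsum_pochRatio_zero v (u + v) (g := fun k : ℕ => (((k : ℂ) + 1) ^ 2)⁻¹)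
    fun k => by
      rw [norm_inv, norm_pow, norm_natCast_add_one]
      exact inv_le_one_of_one_le₀ (one_le_pow₀ (by linarith [(k.cast_nonneg : (0 : ℝ) ≤ k)]))
  have h3 : Tendsto (fun n : ℕ => (Complex.digamma (u + n) - Complex.digamma (u + v + n))
      * (Complex.digamma v - Complex.digamma (u + v + n))) atTop (𝓝 0) := by
    have hc : (fun _ : ℕ => Complex.digamma v) =O[atTop] fun n : ℕ => (n : ℝ) ^ (1 / 2 : ℝ) :=
      (isBigO_const_rpow _ one_half_pos).comp_tendsto tendsto_natCast_atTop_atTop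
    exact tendsto_zero_of_isBigO_rpow (isBigO_rpow_mul_rpow
      (isBigO_rpow_neg_one (isBigO_digamma_sub hu' huv'))
      (hc.sub (isBigO_digamma_add_natCast huv' one_half_pos))) (by norm_num)
  have h4 := (h1.add h2).sub
    (((tendsto_trigamma_add_natCast (u + v)).const_add ((Real.pi : ℂ) ^ 2 / 6)).sub h3)
  simp only [add_zero, sub_zero, sub_self] at h4
  refine tendsto_nhds_unique (tendsto_const_nhds.congr fun n => ?_) h4
  rw [← reflectionDefect_add_natCast_left hu' hv' huv' (by linarith) (by linarith) n,
    reflectionDefect, e]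
  rfl

/-- `∑ₖ ((u)ₖ + (v)ₖ) / ((u + v)ₖ k²) = π²/6 + ψ'(u+v) - (ψ(u) - ψ(u+v)) (ψ(v) - ψ(u+v))`, the
series form of Euler's reflection formula for the dilogarithm integrated against a beta density. -/
lemma pochSumSq_add_pochSumSq {u v : ℂ} (hu : ∀ k : ℕ, u ≠ -k) (hv : ∀ k : ℕ, v ≠ -k)
    (huv : ∀ k : ℕ, u + v ≠ -k) (hu1 : -1 < u.re) (hv1 : -1 < v.re) :
    pochSumSq u (u + v) + pochSumSq v (u + v) = (Real.pi : ℂ) ^ 2 / 6 + trigamma (u + v)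
      - (Complex.digamma u - Complex.digamma (u + v))
        * (Complex.digamma v - Complex.digamma (u + v)) := by
  rw [← sub_eq_zero]
  change reflectionDefect u v = 0
  -- One shift in each argument moves real parts above -1 into the right half plane.
  rw [← reflectionDefect_add_one_left hu hv huv hu1 hv1, reflectionDefect_comm,
    ← reflectionDefect_add_one_left hv (ne_neg_natCast_add_one hu)
      (by rw [← add_assoc, add_comm v u]; exact ne_neg_natCast_add_one huv) hv1
      (by simp; linarith)]
  exact reflectionDefect_eq_zero_of_re_pos (by simp; linarith) (by simp; linarith)

/-! ### Summation by parts for ψ' and ψ². -/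

/-- Summation by parts against `(a)ₗ / (b + 1)ₗ`. -/
lemma hasSum_pochRatio_mul_of_hasSum_sub {a b : ℂ} (ha : ∀ k : ℕ, a ≠ -k) (hb : ∀ k : ℕ, b ≠ -k)
    (hab : b - a ≠ 0) {f : ℕ → ℂ} {s : ℝ} (hf : f =O[atTop] fun n : ℕ => (n : ℝ) ^ s)
    (hs : s < (b - a).re) {S : ℂ}
    (hS : HasSum (fun l => pochRatio a b (l + 1) * (f (l + 1) - f l)) S) :
    HasSum (fun l => pochRatio a (b + 1) l * f l) (b / (b - a) * (f 0 + S)) := by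
  have hb0 := ne_zero_of_ne_neg_natCast hb
  have hsum : Summable fun l => pochRatio a (b + 1) l * f l :=
    summable_of_isBigO_rpow (isBigO_rpow_mul_rpow
      (isBigO_pochRatio ha (ne_neg_natCast_add_one hb)) hf) (by simp at hs ⊢; linarith)
  have h0 := tendsto_zero_of_isBigO_rpow (isBigO_rpow_mul_rpow (isBigO_pochRatio ha hb) hf)
    (by simp at hs ⊢; linarith)
  have hpart : ∀ n, ∑ l ∈ Finset.range n, pochRatio a (b + 1) l * f l
      = b / (b - a) * (f 0 - pochRatio a b n * f n
        + ∑ l ∈ Finset.range n, pochRatio a b (l + 1) * (f (l + 1) - f l)) := by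
    intro n
    induction n with
    | zero => simp
    | succ n ih =>
      have h3 : pochRatio a (b + 1) n
          = b / (b - a) * (pochRatio a b n - pochRatio a b (n + 1)) := by
        rw [pochRatio_sub_succ a hb n]
        field_simp
      rw [Finset.sum_range_succ, Finset.sum_range_succ, ih, h3]
      ring
  have hl := ((h0.const_sub (f 0)).add hS.tendsto_sum_nat).const_mul (b / (b - a))
  rw [sub_zero] at hl
  rw [← tendsto_nhds_unique hsum.hasSum.tendsto_sum_nat (hl.congr fun n => (hpart n).symm)]
  exact hsum.hasSum

lemma trigamma_one : trigamma 1 = (Real.pi : ℂ) ^ 2 / 6 := by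
  have h1 := hasSum_trigamma (z := 1) (by simp)
  have h2 := Complex.hasSum_ofReal.2 ((hasSum_nat_add_iff' 1).2 hasSum_zeta_two)
  refine h1.unique ?_
  simpa [add_comm] using h2

lemma hasSum_pochRatio_mul_trigamma {a b : ℂ} (ha : ∀ k : ℕ, a ≠ -k) (hb : ∀ k : ℕ, b ≠ -k)
    (hab : b - a ≠ 0) (hab1 : -1 < (b - a).re) :
    HasSum (fun l : ℕ => pochRatio a (b + 1) l * trigamma (1 + l))
      (b / (b - a) * ((Real.pi : ℂ) ^ 2 / 6 - pochSumSq a b)) := by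
  have h1 : ∀ k : ℕ, (1 : ℂ) ≠ -k := ne_neg_natCast_of_re_pos (by simp)
  have h := hasSum_pochRatio_mul_of_hasSum_sub ha hb hab
    (isBigO_rpow_neg_one (isBigO_trigamma h1)) hab1 (S := -pochSumSq a b) ?_
  · simpa [trigamma_one, sub_eq_add_neg] using h
  · refine (summable_pochRatio_mul_inv_sq ha hb hab1).hasSum.neg.congr_fun fun l => ?_
    push_cast
    rw [← add_assoc, trigamma_add_one (ne_neg_natCast_add h1 l), add_comm (1 : ℂ)]
    ring

lemma hasSum_pochRatio_mul_digamma_sq {a b : ℂ} (ha : ∀ k : ℕ, a ≠ -k) (hb : ∀ k : ℕ, b ≠ -k)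
    (hab : 0 < (b - a).re) :
    HasSum (fun l : ℕ => pochRatio a (b + 1) l * Complex.digamma (1 + l) ^ 2)
      (b / (b - a) * ((Real.eulerMascheroniConstant : ℂ) ^ 2
        + (Complex.digamma b - Complex.digamma (b - a)) ^ 2 + (trigamma (b - a) - trigamma b)
        - 2 * Real.eulerMascheroniConstant * (Complex.digamma b - Complex.digamma (b - a))
        + pochSumSq a b)) := by
  have h1 : ∀ k : ℕ, (1 : ℂ) ≠ -k := ne_neg_natCast_of_re_pos (by simp)
  have hba : b - a ≠ 0 := by intro h; rw [h] at hab; simp at hab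
  -- Two factors ψ then grow with total exponent Re(b-a)/2, below the limit Re(b-a) for summation by
  -- parts.
  have hε : 0 < (b - a).re / 4 := by positivity
  have hf : (fun l : ℕ => Complex.digamma (1 + l) ^ 2) =O[atTop]
      fun n : ℕ => (n : ℝ) ^ ((b - a).re / 4 + (b - a).re / 4) :=
    (isBigO_rpow_mul_rpow (isBigO_digamma_one_add_natCast hε)
      (isBigO_digamma_one_add_natCast hε)).congr_left fun n => (sq _).symm
  -- With ψ(1+l) = Hₗ - γ, the increment of ψ² is 2Hₗ/(l+1) - 2γ/(l+1) + 1/(l+1)².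
  have hS := (((hasSum_pochRatio_mul_harmonic_mul_inv ha hb hab).mul_left 2).sub
    ((hasSum_pochRatio_mul_inv ha hb hab).mul_left (2 * (Real.eulerMascheroniConstant : ℂ)))).add
    (summable_pochRatio_mul_inv_sq ha hb (by linarith)).hasSum
  have h := hasSum_pochRatio_mul_of_hasSum_sub ha hb hba hf (by linarith)
    (hS.congr_fun fun l => by
      have hl : (l : ℂ) + 1 ≠ 0 := Nat.cast_add_one_ne_zero l
      rw [digamma_one_add_natCast, digamma_one_add_natCast, harmonic_succ]
      push_cast
      field_simp
      ring)
  convert h using 2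
  rw [Nat.cast_zero, add_zero, Complex.digamma_one, pochSumSq]
  ring

/-! ### The ₄F₃ series and the theorem. -/

lemma genHypTerm_eq_pochRatio (a b : ℂ) (k : ℕ) :
    genHypTerm [1, 1, 1, a] [2, 2, b] 1 k = pochRatio a b k * (((k : ℂ) + 1) ^ 2)⁻¹ := by
  have h1 : (ascPochhammer ℂ k).eval 1 = (k.factorial : ℂ) := by
    rw [ascPochhammer_eval_one]
  have h2 : (ascPochhammer ℂ k).eval 2 = ((k : ℂ) + 1) * (k.factorial : ℂ) := by
    induction k with
    | zero => simp
    | succ k ih =>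
      rw [ascPochhammer_succ_eval, ih (by rw [ascPochhammer_eval_one]), Nat.factorial_succ]
      push_cast
      ring
  have hk : (k : ℂ) + 1 ≠ 0 := Nat.cast_add_one_ne_zero k
  have hf : (k.factorial : ℂ) ≠ 0 := by exact_mod_cast k.factorial_ne_zero
  simp only [genHypTerm, List.map_cons, List.map_nil, List.prod_cons, List.prod_nil, h1, h2,
    one_pow, pochRatio]
  field_simp

lemma summable_genHypTerm {a b : ℂ} (ha : ∀ k : ℕ, a ≠ -k) (hb : ∀ k : ℕ, b ≠ -k)
    (hab : -1 < (b - a).re) : Summable (genHypTerm [1, 1, 1, a] [2, 2, b] 1) := by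
  simp only [funext (genHypTerm_eq_pochRatio a b)]
  exact summable_of_isBigO_rpow (isBigO_rpow_mul_rpow (isBigO_pochRatio ha hb)
    isBigO_inv_natCast_add_one_sq) (by simp at hab ⊢; linarith)

lemma pochSumSq_eq_genHyp (a b : ℂ) :
    pochSumSq a b = a / b * genHyp [1, 1, 1, a + 1] [2, 2, b + 1] 1 := by
  rw [pochSumSq, genHyp, ← tsum_mul_left]
  refine tsum_congr fun k => ?_
  rw [genHypTerm_eq_pochRatio, pochRatio_succ', mul_assoc]

lemma ne_neg_natCast_of_neg_one_lt_re {z : ℂ} (hz : -1 < z.re) (hz0 : z ≠ 0) (k : ℕ) : z ≠ -k := by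
  rcases k with _ | k
  · simpa using hz0
  · rintro rfl
    have : (0 : ℝ) ≤ k := k.cast_nonneg
    simp at hz
    linarith

theorem theorem4p11 (c m : ℂ) (hc : -1 < c.re) (hc0 : c ≠ 0)
    (hmc : 0 < (m - c).re) (hm0 : m ≠ 0) (hm1 : m ≠ 1) :
    Summable (genHypTerm [1, 1, 1, m - c] [2, 2, m] 1) ∧
    (1 < (m - c).re →
      HasSum
        (fun l : ℕ => Complex.Gamma (c + l) * Complex.digamma (1 + l) ^ 2 / Complex.Gamma (m + l))
        (-(Complex.Gamma c / Complex.Gamma m) * genHyp [1, 1, 1, m - c] [2, 2, m] 1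
          + Complex.Gamma c / (Complex.Gamma (m - 1) * (m - 1 - c)) *
            ((Real.pi : ℂ) ^ 2 / 6 + (Real.eulerMascheroniConstant : ℂ) ^ 2
              + Complex.digamma (m - 1 - c) *
                (2 * (Real.eulerMascheroniConstant : ℂ)
                  - Complex.digamma (m - 1) - Complex.digamma c)
              + trigamma (m - 1 - c)
              + Complex.digamma (m - 1 - c) ^ 2
              - Complex.digamma (m - 1) *
                (2 * (Real.eulerMascheroniConstant : ℂ) - Complex.digamma c)))) ∧
    (m ≠ c + 1 →
      HasSum
        (fun l : ℕ => Complex.Gamma (c + l) * trigamma (1 + l) / Complex.Gamma (m + l))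
        (Complex.Gamma c / Complex.Gamma m * genHyp [1, 1, 1, m - c] [2, 2, m] 1
          - Complex.Gamma c / (Complex.Gamma (m - 1) * (m - 1 - c)) *
            (trigamma (m - 1)
              - (Complex.digamma (m - 1) - Complex.digamma (m - 1 - c)) *
                (Complex.digamma (m - 1) - Complex.digamma c)))) := by
  have hcN := ne_neg_natCast_of_neg_one_lt_re hc hc0
  have hmN : ∀ k : ℕ, m ≠ -k := ne_neg_natCast_of_neg_one_lt_re (by simp at hmc; linarith) hm0
  have hbN : ∀ k : ℕ, m - 1 ≠ -k := by
    rintro (_ | k) h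
    · exact hm1 (by simpa [sub_eq_zero] using h)
    · exact hmN k (by push_cast at h; linear_combination h)
  have hb0 := ne_zero_of_ne_neg_natCast hbN
  have hG1 := Complex.Gamma_ne_zero hbN
  have hG : Complex.Gamma m = (m - 1) * Complex.Gamma (m - 1) := by
    have := Complex.Gamma_add_one _ hb0
    rwa [sub_add_cancel] at this
  have hu1 : -1 < (m - 1 - c).re := by simp at hmc ⊢; linarith
  have hcoef : ∀ l : ℕ, Complex.Gamma (c + l) / Complex.Gamma (m + l)
      = Complex.Gamma c / Complex.Gamma m * pochRatio c (m - 1 + 1) l := fun l => by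
    rw [sub_add_cancel, Gamma_add_natCast_div hcN hmN]
  -- Reflection with u = m-1-c, v = c, where `pochSumSq u (u + v)` is a multiple of the ₄F₃. Only Re
  -- u > -1 and u ≠ 0 are available in part (b), so the reflection formula is needed beyond the
  -- right half plane.
  have hrefl : m - 1 - c ≠ 0 → pochSumSq c (m - 1) = (Real.pi : ℂ) ^ 2 / 6 + trigamma (m - 1)
      - (Complex.digamma (m - 1 - c) - Complex.digamma (m - 1))
        * (Complex.digamma c - Complex.digamma (m - 1))
      - (m - 1 - c) / (m - 1) * genHyp [1, 1, 1, m - c] [2, 2, m] 1 := fun hu0 => by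
    have h := pochSumSq_add_pochSumSq (ne_neg_natCast_of_neg_one_lt_re hu1 hu0) hcN
      (by simpa using hbN) hu1 hc
    have h2 := pochSumSq_eq_genHyp (m - 1 - c) (m - 1)
    rw [show m - 1 - c + 1 = m - c by ring, sub_add_cancel] at h2
    rw [sub_add_cancel, h2] at h
    linear_combination h
  refine ⟨summable_genHypTerm (ne_neg_natCast_of_re_pos hmc) hmN (by simpa using hc), fun hre => ?_,
    fun hne => ?_⟩
  · have hu : 0 < (m - 1 - c).re := by simp at hre ⊢; linarith
    have hu0 : m - 1 - c ≠ 0 := by intro h; rw [h] at hu; simp at hu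
    have h := (hasSum_pochRatio_mul_digamma_sq hcN hbN hu).mul_left
      (Complex.Gamma c / Complex.Gamma m)
    rw [hrefl hu0] at h
    refine Eq.subst (motive := fun x => HasSum _ x) ?_ (h.congr_fun fun l => ?_)
    · rw [hG]
      field_simp
      ring
    · rw [← mul_assoc, ← hcoef, div_mul_eq_mul_div]
  · have hu0 : m - 1 - c ≠ 0 := fun h => hne (by linear_combination h)
    have h := (hasSum_pochRatio_mul_trigamma hcN hbN hu0 hu1).mul_left
      (Complex.Gamma c / Complex.Gamma m)
    rw [hrefl hu0] at h
    refine Eq.subst (motive := fun x => HasSum _ x) ?_ (h.congr_fun fun l => ?_)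
    · rw [hG]
      field_simp
      ring
    · rw [← mul_assoc, ← hcoef, div_mul_eq_mul_div]
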